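/- **Conventions.** Let $\mathbb{R}[\mathbf{x}]=\mathbb{R}[x_1,\dots,x_n]$ with the ranking $x_n>\dots>x_1$. The *leader* of a non-constant polynomial $p$ is the highest-ranking variable $x$ appearing in $p$; its *initial* $i_p$ is the coefficient of the highest power of $x$ in $p$ (viewed as a univariate polynomial in $x$), and its *separant* is $s_p=\partial p/\partial x$. Constants have no leader, initial or separant. For an ideal $I$ and a set $S$, $I:S^\infty$ is the set of all $p$ such that $sp\in I$ for some $s$ in the multiplicative set generated by $S$. Fix a subgroup $U\le\mathbb{R}^\times$; "$S$ contains $f$'' for a separant $f$ means that $uf\in S$ for some $u\in U$ (for $U=\{1\}$ this is literal membership; for $U=\mathbb{R}^\times$ nonzero constant multiples are disregarded). A finite set $A$ is *triangular* if no two different non-constant elements have the same leader. For finite $A,S\subseteq\mathbb{R}[\mathbf{x}]$, the pair $(A,S)$ is a *regular algebraic system* if $0\notin S$, $A$ is triangular, and $S$ contains the separant of each non-constant element of $A$. A *single pseudodivision step* of $p$ by a non-constant $q$ with leader $x$, where $d=\deg_x p\ge e=\deg_x q$ and $c$ is the coefficient of $x^d$ in $p$, produces $r=\alpha p-\beta x^{d-e}q$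 for some factor $\alpha$ of $i_q$ and some $\beta$ with $\alpha c=\beta i_q$ (for example $\alpha=i_q/g$, $\beta=c/g$ with $g=\gcd(i_q,c)$). **Algorithm** $\mathtt{Triangulate}(A,S)$. 1. If $A$ is triangular and $S$ contains the separant of each non-constant $q\in A$, return $\{(A,S)\}$. Otherwise let $x$ be the highest-ranking variable that is the leader of several elements of $A$, or the leader of exactly one $q\in A$ with $s_q$ not contained in $S$. Among the elements of $A$ with leader $x$ choose $q$ of minimal degree in $x$, and of least total degree among those of minimal degree in $x$. Put $\widetilde A=(A\cup\{i_q,\;q-i_qx^{\deg_x q}\})\setminus\{q\}$ and $\hat S=S\cup\{i_q\}$. 2. If several elements of $A$ have leader $x$, choose $p\ne q$ of maximal degree in $x$ among the elements of $A$ with leader $x$, and of greatest total degree among the candidates $p\neq q$ of maximal degree in $x$. Let $r$ result from a single pseudodivision step of $p$ by $q$, and let $\hat A=(A\cup\{r\})\setminus\{p\}$. Return $\mathtt{Triangulate}(\widetilde A,S)\cup\mathtt{Triangulate}(\hat A\cup\{s_q\},\hat S)\cup\mathtt{Triangulate}(\hat A,\hat S\cup\{s_q\})$. 3. If $q$ is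 the only element of $A$ with leader $x$: (a) if $\hat S$ contains $s_q$, return $\mathtt{Triangulate}(\widetilde A,S)\cup\mathtt{Triangulate}(A,\hat S)$; (b) otherwise let $r$ result from a single pseudodivision step of $q$ by $s_q$, and return $\mathtt{Triangulate}(\widetilde A,S)\cup\mathtt{Triangulate}((A\cup\{s_q,r\})\setminus\{q\},\hat S)\cup\mathtt{Triangulate}(A,\hat S\cup\{s_q\})$. **Theorem.** Let $A\subseteq\mathbb{R}[\mathbf{x}]$ and $S\subseteq\mathbb{R}[\mathbf{x}]\setminus\{0\}$ be finite. Then $\mathtt{Triangulate}(A,S)$ terminates, whatever choices are made: there is no infinite chain of recursive calls starting from $(A,S)$, and from every pair on which the algorithm may be called recursively, starting from $(A,S)$, there is a complete execution that returns an output. Every possible output is a finite set $\{(A_1,S_1),\dots,(A_r,S_r)\}$ of regular algebraic systems (so $S_i\subseteq\mathbb{R}[\mathbf{x}]\setminus\{0\}$, $A_i$ is triangular, and $S_i$ contains the separants of $A_i$) with $$\sqrt{(A):S^\infty}=\big((A_1):S_1^\infty\big)\cap\dots\cap\big((A_r):S_r^\infty\big).$$ -/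

import Mathlib

namespace Triang

open MvPolynomial

/-- The saturation `I : S^∞` of an ideal `I` by the multiplicative set generated by `S`. -/
def saturation {R : Type*} [CommRing R] (I : Ideal R) (S : Set R) : Ideal R where
  carrier := {p | ∃ s ∈ Submonoid.closure S, s * p ∈ I}
  zero_mem' := ⟨1, Submonoid.one_mem _, by simp⟩
  add_mem' := by
    rintro a b ⟨s, hs, ha⟩ ⟨t, ht, hb⟩
    refine ⟨s * t, Submonoid.mul_mem _ hs ht, ?_⟩
    have h : s * t * (a + b) = t * (s * a) + s * (t * b) := by ring
    rw [h]
    exact I.add_mem (I.mul_mem_left _ ha) (I.mul_mem_left _ hb)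
  smul_mem' := by
    rintro c a ⟨s, hs, ha⟩
    refine ⟨s, hs, ?_⟩
    have h : s * (c • a) = c * (s * a) := by simp only [smul_eq_mul]; ring
    rw [h]
    exact I.mul_mem_left _ ha

/-- Real polynomials in the variables `x_0 < x_1 < ... < x_(n-1)`; the ranking is the usual order
on the indices. -/
abbrev Poly (n : ℕ) : Type := MvPolynomial (Fin n) ℝ

/-- A pair `(A, S)` of a finite set of equations and a finite set of inequations. -/
abbrev System (n : ℕ) : Type := Finset (Poly n) × Finset (Poly n)

variable {n : ℕ}

/-- `x` is the leader of `p`: the highest ranking variable that appears in `p`.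
Constants have no leader. -/
def IsLeader (p : Poly n) (x : Fin n) : Prop :=
  IsGreatest {y | y ∈ p.vars} x

/-- The coefficient of `x ^ d` in `p`, where `p` is viewed as a univariate polynomial in `x` whose
coefficients are polynomials in the other variables. -/
noncomputable def coeffIn (x : Fin n) (d : ℕ) (p : Poly n) : Poly n :=
  ∑ m ∈ p.support with m x = d, monomial (m.erase x) (p.coeff m)

/-- The coefficient of the highest power of `x` that appears in `p`.
If `x` is the leader of `p`, this is the initial of `p`. -/
noncomputable def initialIn (x : Fin n) (p : Poly n) : Poly n :=
  coeffIn x (p.degreeOf x) p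

/-- The formal partial derivative of `p` with respect to `x`.
If `x` is the leader of `p`, this is the separant of `p`. -/
noncomputable def separantIn (x : Fin n) (p : Poly n) : Poly n :=
  pderiv x p

/-- `p` with its term of highest degree in `x` removed. -/
noncomputable def tailIn (x : Fin n) (p : Poly n) : Poly n :=
  p - initialIn x p * X x ^ p.degreeOf x

/-- `S` contains `f` up to a scalar factor from the group `U` of nonzero constants.
For `U = ⊥` this is literal membership; for `U = ⊤` nonzero constant multiples are disregarded. -/
def Contains (U : Subgroup ℝˣ) (S : Finset (Poly n)) (f : Poly n) : Prop :=
  ∃ u ∈ U, C (u : ℝ) * f ∈ S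

/-- No two elements have the same leader. -/
def IsTriangular (A : Finset (Poly n)) : Prop :=
  ∀ p ∈ A, ∀ q ∈ A, ∀ x, IsLeader p x → IsLeader q x → p = q

/-- `S` contains the separant of each (non-constant) element of `A`. -/
def HasSeparants (U : Subgroup ℝˣ) (A S : Finset (Poly n)) : Prop :=
  ∀ q ∈ A, ∀ x, IsLeader q x → Contains U S (separantIn x q)

/-- `(A = 0, S ≠ 0)` is a regular algebraic system. -/
structure IsRegularSystem (U : Subgroup ℝˣ) (A S : Finset (Poly n)) : Prop where
  zero_notMem : 0 ∉ S
  triangular : IsTriangular A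
  separants : HasSeparants U A S

/-- A single step of pseudodivision of `p` by `q` may produce `r`. With `x` the leader of `q`,
`d = deg_x p ≥ e = deg_x q` and `c` the coefficient of `x ^ d` in `p`, the dividend `p` is
premultiplied by a factor `α` of the initial `i_q` such that `i_q` divides `α * c`, and the
multiple `(α * c / i_q) * x ^ (d - e) * q` of `q` is subtracted, which cancels the term in `x ^ d`.
The choice `α = i_q / g`, `α * c / i_q = c / g` with `g` any gcd of `i_q` and `c` is an instance. -/
def PseudoStep (p q r : Poly n) : Prop :=
  ∃ x, IsLeader q x ∧ q.degreeOf x ≤ p.degreeOf x ∧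
    ∃ α β : Poly n, α ∣ initialIn x q ∧ α * initialIn x p = β * initialIn x q ∧
      r = α * p - β * X x ^ (p.degreeOf x - q.degreeOf x) * q

/-- `q` is the only element of `A` with leader `x`. -/
def IsLone (A : Finset (Poly n)) (x : Fin n) (q : Poly n) : Prop :=
  q ∈ A ∧ IsLeader q x ∧ ∀ p ∈ A, IsLeader p x → p = q

/-- `x` is the leader of several elements of `A`. -/
def IsShared (A : Finset (Poly n)) (x : Fin n) : Prop :=
  ∃ p ∈ A, ∃ q ∈ A, p ≠ q ∧ IsLeader p x ∧ IsLeader q x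

/-- `x` is the target variable of `(A, S)`: the highest ranking variable that is the leader of
several elements of `A`, or of only one `q ∈ A` whose separant is not in `S`. -/
def IsTarget (U : Subgroup ℝˣ) (A S : Finset (Poly n)) (x : Fin n) : Prop :=
  IsGreatest {y | IsShared A y ∨ ∃ q, IsLone A y q ∧ ¬ Contains U S (separantIn y q)} x

/-- `q` is a legal divisor: among the elements of `A` with leader `x` it has minimal degree in `x`,
and least total degree among those of minimal degree in `x`. -/
def IsDivisor (A : Finset (Poly n)) (x : Fin n) (q : Poly n) : Prop :=
  q ∈ A ∧ IsLeader q x ∧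
    (∀ f ∈ A, IsLeader f x → q.degreeOf x ≤ f.degreeOf x) ∧
    ∀ f ∈ A, IsLeader f x → f.degreeOf x = q.degreeOf x → q.totalDegree ≤ f.totalDegree

/-- `p ≠ q` is a legal dividend: among the elements of `A` with leader `x` it has maximal degree in
`x`, and greatest total degree among those different from `q` of maximal degree in `x`. -/
def IsDividend (A : Finset (Poly n)) (x : Fin n) (q p : Poly n) : Prop :=
  p ∈ A ∧ p ≠ q ∧ IsLeader p x ∧
    (∀ f ∈ A, IsLeader f x → f.degreeOf x ≤ p.degreeOf x) ∧
    ∀ f ∈ A, f ≠ q → IsLeader f x → f.degreeOf x = p.degreeOf x → f.totalDegree ≤ p.totalDegree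

/-- The equations `Ã = (A ∪ {i_q, tail of q}) \ {q}`. -/
noncomputable def tildeEqs (A : Finset (Poly n)) (x : Fin n) (q : Poly n) : Finset (Poly n) :=
  (A ∪ {initialIn x q, tailIn x q}) \ {q}

/-- The inequations `Ŝ = S ∪ {i_q}`. -/
noncomputable def hatIneqs (S : Finset (Poly n)) (x : Fin n) (q : Poly n) : Finset (Poly n) :=
  S ∪ {initialIn x q}

/-- The body of `Triangulate`, as a relation because of the free choices in it:
`Body U P L` says that the call on `P` may issue exactly the recursive calls listed in `L`. -/
inductive Body (U : Subgroup ℝˣ) : System n → List (System n) → Prop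
  | shared {A S : Finset (Poly n)} {x : Fin n} {q p r : Poly n}
      (target : IsTarget U A S x) (divisor : IsDivisor A x q)
      (shared : IsShared A x) (dividend : IsDividend A x q p) (step : PseudoStep p q r) :
      Body U (A, S)
        [(tildeEqs A x q, S),
         (((A ∪ {r}) \ {p}) ∪ {separantIn x q}, hatIneqs S x q),
         ((A ∪ {r}) \ {p}, hatIneqs S x q ∪ {separantIn x q})]
  | loneMem {A S : Finset (Poly n)} {x : Fin n} {q : Poly n}
      (target : IsTarget U A S x) (divisor : IsDivisor A x q)
      (lone : IsLone A x q) (mem : Contains U (hatIneqs S x q) (separantIn x q)) :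
      Body U (A, S)
        [(tildeEqs A x q, S),
         (A, hatIneqs S x q)]
  | loneNotMem {A S : Finset (Poly n)} {x : Fin n} {q r : Poly n}
      (target : IsTarget U A S x) (divisor : IsDivisor A x q)
      (lone : IsLone A x q) (notMem : ¬ Contains U (hatIneqs S x q) (separantIn x q))
      (step : PseudoStep q (separantIn x q) r) :
      Body U (A, S)
        [(tildeEqs A x q, S),
         ((A ∪ {separantIn x q, r}) \ {q}, hatIneqs S x q),
         (A, hatIneqs S x q ∪ {separantIn x q})]

/-- Some execution of the call on `P` issues the recursive call on `Q`. -/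
def Calls (U : Subgroup ℝˣ) (P Q : System n) : Prop :=
  ∃ L, Body U P L ∧ Q ∈ L

/-- `Returns U P O`: some complete execution of `Triangulate` on input `P` returns the finite set
`O` of systems. -/
inductive Returns (U : Subgroup ℝˣ) : System n → Finset (System n) → Prop
  | done {A S : Finset (Poly n)} (triangular : IsTriangular A) (separants : HasSeparants U A S) :
      Returns U (A, S) {(A, S)}
  | split {P : System n} {L : List (System n)} (body : Body U P L)
      (O : Fin L.length → Finset (System n)) (rec : ∀ i, Returns U (L.get i) (O i)) :
      Returns U P (Finset.univ.biUnion O)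

end Triang

/-! Termination: to each variable `y` attach twice the sum of `3 ^ deg_y` over the equations with
leader `y`, plus one if `y` still needs treatment. These numbers drop lexicographically, highest
variable first, in every call. At the target `x`, either one equation is replaced by at most two of
lower degree in `x` (`Replaces.weight_lt`), or the equations stay and the missing separant enters
`S`, which clears the extra one. Above `x` nothing changes (`measureAt_eq_of_lt`).

Correctness: the radical of `(A) : S^∞` is the intersection of the primes that contain `A` and avoid
`S`. A call sorts these primes by whether they contain `i_q` and, where needed, `s_q`; modulo a
prime that contains the divisor but not its initial, dividend and pseudoremainder are
interchangeable (`Body.isZero_iff`). So radicals intersect along the recursion.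

At the leaves the radical is superfluous by Lazard's lemma (`isRadical_saturation`): the Jacobian
matrix of a triangular set with respect to its leaders is triangular with the separants on the
diagonal. Inverting them makes the quotient étale over the polynomial ring in the other variables,
which is a domain, so the quotient becomes reduced. -/

namespace Triang

open MvPolynomial

/-! ### Étale algebras and the Jacobian criterion -/

/-- An étale algebra over a domain is reduced. -/
theorem isReduced_of_etale {R B : Type*} [CommRing R] [IsDomain R] [CommRing B] [Algebra R B]
    [Algebra.Etale R B] : IsReduced B := by
  let K := FractionRing R
  have hred : IsReduced (TensorProduct R K B) :=
    Algebra.FormallyUnramified.isReduced_of_field K (TensorProduct R K B)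
  -- Étale algebras are flat, so `R ⊆ K` stays injective after tensoring with `B`.
  have hinj : Function.Injective
      (Algebra.TensorProduct.includeRight : B →ₐ[R] TensorProduct R K B) :=
    Algebra.TensorProduct.includeRight_injective (IsFractionRing.injective R K)
  exact isReduced_of_injective _ hinj

/-- Jacobian criterion: up to powers of the Jacobian determinant, an ideal generated by as many
polynomials as there are variables is radical. -/
theorem exists_det_pow_mul_mem_span {R σ : Type*} [CommRing R] [IsDomain R] [Fintype σ]
    [DecidableEq σ] (v : σ → MvPolynomial σ R) {p : MvPolynomial σ R} {m : ℕ}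
    (hp : p ^ m ∈ Ideal.span (Set.range v)) :
    ∃ k, (Matrix.of fun i j => pderiv i (v j)).det ^ k * p ∈ Ideal.span (Set.range v) := by
  classical
  set I := Ideal.span (Set.range v)
  set J := (Matrix.of fun i j => pderiv i (v j)).det with hJ
  let Q := MvPolynomial σ R ⧸ I
  let j : Q := Ideal.Quotient.mk I J
  let P : Algebra.PreSubmersivePresentation R Q σ σ :=
    Algebra.PreSubmersivePresentation.naive (v := v) id Function.injective_id
  have hPj : P.jacobian = j := by
    rw [Algebra.PreSubmersivePresentation.jacobian_eq_jacobiMatrix_det]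
    have : P.jacobiMatrix = Matrix.of fun i j => pderiv i (v j) := by
      ext1 a b
      exact Algebra.PreSubmersivePresentation.jacobiMatrix_naive _ _ _ _ _ _
    rw [this, ← hJ]
    rfl
  let B := Localization.Away j
  -- Inverting `j` costs one generator and one relation, so the composite presentation of `B`
  -- remains square, and its Jacobian is a product of images of `j`.
  let L := Algebra.PreSubmersivePresentation.localizationAway B j
  have hunit : IsUnit (L.comp P).jacobian := by
    rw [Algebra.PreSubmersivePresentation.comp_jacobian_eq_jacobian_smul_jacobian,
      Algebra.PreSubmersivePresentation.localizationAway_jacobian, hPj, Algebra.smul_def]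
    have hj : IsUnit (algebraMap Q B j) := IsLocalization.Away.algebraMap_isUnit j
    simpa using hj
  let T : Algebra.SubmersivePresentation R B (Unit ⊕ σ) (Unit ⊕ σ) :=
    { toPreSubmersivePresentation := L.comp P, jacobian_isUnit := hunit }
  -- As many relations as generators: smooth of relative dimension zero, that is, étale.
  have hdim : T.dimension = 0 := by
    simp [Algebra.Presentation.dimension]
  have := T.isStandardSmoothOfRelativeDimension hdim
  have hred : IsReduced B := isReduced_of_etale (R := R)
  have h0 : algebraMap Q B (Ideal.Quotient.mk I p) = 0 := by
    refine IsReduced.eq_zero _ ⟨m, ?_⟩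
    rw [← map_pow, ← map_pow, Ideal.Quotient.eq_zero_iff_mem.2 hp, map_zero]
  obtain ⟨⟨_, k, rfl⟩, hk⟩ := (IsLocalization.map_eq_zero_iff (Submonoid.powers j) B _).1 h0
  refine ⟨k, Ideal.Quotient.eq_zero_iff_mem.1 ?_⟩
  simpa using hk

variable {n : ℕ}

/-! ### Leaders and Lazard's lemma -/

theorem IsLeader.unique {p : Poly n} {x y : Fin n} (hx : IsLeader p x) (hy : IsLeader p y) :
    x = y :=
  IsGreatest.unique hx hy

theorem isLeader_iff {p : Poly n} {x : Fin n} :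
    IsLeader p x ↔ 0 < p.degreeOf x ∧ ∀ y, x < y → p.degreeOf y = 0 := by
  simp only [IsLeader, IsGreatest, mem_upperBounds, Set.mem_ofPred_eq, mem_vars_iff_degreeOf_ne_zero,
    Nat.pos_iff_ne_zero]
  exact and_congr_right fun _ => ⟨fun h y hy => by_contra fun h0 => (h y h0).not_gt hy,
    fun h y hy => not_lt.1 fun hlt => hy (h y hlt)⟩

theorem exists_isLeader_or_eq_C (p : Poly n) : (∃ x, IsLeader p x) ∨ ∃ a, p = C a := by
  rcases p.vars.eq_empty_or_nonempty with h | h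
  · exact Or.inr ⟨_, vars_eq_empty_iff_eq_C.1 h⟩
  · exact Or.inl ⟨p.vars.max' h, p.vars.max'_mem h, fun y hy => p.vars.le_max' y hy⟩

theorem apply_mem_span_range_iff {R R' ι : Type*} [CommRing R] [CommRing R'] (e : R ≃+* R')
    (v : ι → R) (f : R) :
    e f ∈ Ideal.span (Set.range fun i => e (v i)) ↔ f ∈ Ideal.span (Set.range v) := by
  have h : Ideal.span (Set.range fun i => e (v i)) = (Ideal.span (Set.range v)).map e := by
    rw [Ideal.map_span, ← Set.range_comp]
    rfl
  rw [h, Ideal.mem_map_of_equiv]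
  exact ⟨fun ⟨g, hg, hgf⟩ => e.injective hgf ▸ hg, fun hf => ⟨f, hf, rfl⟩⟩

/-- Jacobian criterion for a subset of the variables; the other variables are parameters. -/
theorem exists_det_pow_mul_mem_span_of_subset {R τ : Type*} [CommRing R] [IsDomain R]
    (L : Set τ) [Fintype L] [DecidableEq L] (v : L → MvPolynomial τ R) {p : MvPolynomial τ R}
    {m : ℕ} (hp : p ^ m ∈ Ideal.span (Set.range v)) :
    ∃ k, (Matrix.of fun i j : L => pderiv (i : τ) (v j)).det ^ k * p ∈
      Ideal.span (Set.range v) := by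
  classical
  -- The variables outside `L` move into the coefficient ring, which is still a domain; the family
  -- `v` is then square.
  let e : L ⊕ (Lᶜ : Set τ) ≃ τ := Equiv.Set.sumCompl L
  let Φ : MvPolynomial τ R ≃ₐ[R] MvPolynomial L (MvPolynomial (Lᶜ : Set τ) R) :=
    (renameEquiv R e.symm).trans (sumAlgEquiv R _ _)
  have hd : ∀ (i : L) (f : MvPolynomial τ R), pderiv i (Φ f) = Φ (pderiv (i : τ) f) := by
    intro i f
    have h1 : e.symm (i : τ) = Sum.inl i := Equiv.Set.sumCompl_symm_apply i
    simp only [Φ, AlgEquiv.trans_apply, renameEquiv_apply, pderiv_sumAlgEquiv]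
    rw [← h1, pderiv_rename e.symm.injective]
  have hspan : ∀ f, Φ f ∈ Ideal.span (Set.range fun i => Φ (v i)) ↔
      f ∈ Ideal.span (Set.range v) := by
    exact fun f => apply_mem_span_range_iff Φ.toRingEquiv v f
  obtain ⟨k, hk⟩ := exists_det_pow_mul_mem_span (fun i => Φ (v i)) (p := Φ p) (m := m)
    (by rw [← map_pow]; exact (hspan _).2 hp)
  refine ⟨k, (hspan _).1 ?_⟩
  have hdet : Φ (Matrix.of fun i j : L => pderiv (i : τ) (v j)).det =
      (Matrix.of fun i j => pderiv i (Φ (v j))).det := by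
    rw [AlgEquiv.map_det]
    congr 1
    ext1 i j
    simp [hd]
  rwa [map_mul, map_pow, hdet]

/-- **Lazard's lemma**: the saturation of a triangular set by its separants is radical. -/
theorem isRadical_saturation {U : Subgroup ℝˣ} {A S : Finset (Poly n)}
    (hA : IsTriangular A) (hS : HasSeparants U A S) :
    (saturation (Ideal.span (A : Set (Poly n))) (S : Set (Poly n))).IsRadical := by
  classical
  rintro p ⟨m, s, hs, hp⟩
  -- Triangularity says nothing about constants. A nonzero one generates the unit ideal, and zero
  -- contributes nothing.
  by_cases hc : ∃ a : ℝ, a ≠ 0 ∧ (C a : Poly n) ∈ A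
  · obtain ⟨a, ha, haA⟩ := hc
    have htop : Ideal.span (A : Set (Poly n)) = ⊤ :=
      Ideal.eq_top_of_isUnit_mem _ (Ideal.subset_span haA) ((isUnit_iff_ne_zero.2 ha).map C)
    exact ⟨1, Submonoid.one_mem _, by simp [htop]⟩
  let L : Set (Fin n) := {x | ∃ q ∈ A, IsLeader q x}
  choose v hvA hv using fun x : L => x.2
  have hspan : Ideal.span (A : Set (Poly n)) = Ideal.span (Set.range v) := by
    refine le_antisymm (Ideal.span_le.2 fun q hq => ?_) (Ideal.span_mono ?_)
    · rcases exists_isLeader_or_eq_C q with ⟨x, hx⟩ | ⟨a, rfl⟩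
      · have : q = v ⟨x, q, hq, hx⟩ := hA _ hq _ (hvA _) x hx (hv _)
        exact this ▸ Ideal.subset_span ⟨_, rfl⟩
      · have : a = 0 := by_contra fun h => hc ⟨a, h, hq⟩
        simp [this]
    · rintro _ ⟨x, rfl⟩
      exact hvA x
  rw [hspan] at hp
  -- The exponent `m + 1` covers `m = 0`, where only `s` itself is known to lie in the ideal.
  have hp' : (s * p) ^ (m + 1) ∈ Ideal.span (Set.range v) := by
    have : (s * p) ^ (m + 1) = s ^ m * p * (s * p ^ m) := by ring
    rw [this]
    exact Ideal.mul_mem_left _ _ hp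
  obtain ⟨k, hk⟩ := exists_det_pow_mul_mem_span_of_subset L v hp'
  -- No variable above the leader `j` occurs in `v j`, so the entries with `j < i` vanish.
  have hdet : (Matrix.of fun i j : L => pderiv (i : Fin n) (v j)).det =
      ∏ x : L, separantIn (x : Fin n) (v x) := by
    refine Matrix.det_of_isUpperTriangular fun i j hij => ?_
    exact pderiv_eq_zero_of_notMem_vars fun h => not_le.2 hij ((hv j).2 h)
  -- `S` contains the separants only up to constants; the surplus constants are absorbed by the
  -- ideal.
  choose u _ hu using fun x : L => hS _ (hvA x) x (hv x)
  have hmem : (∏ x : L, C (u x : ℝ) * separantIn (x : Fin n) (v x)) ∈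
      Submonoid.closure (S : Set (Poly n)) :=
    Submonoid.prod_mem _ fun x _ => Submonoid.subset_closure (hu x)
  refine ⟨(∏ x : L, C (u x : ℝ) * separantIn (x : Fin n) (v x)) ^ k * s,
    Submonoid.mul_mem _ (Submonoid.pow_mem _ hmem k) hs, ?_⟩
  rw [hspan, Finset.prod_mul_distrib, ← hdet, mul_pow, mul_assoc, mul_assoc]
  exact Ideal.mul_mem_left _ _ hk

/-! ### Saturations and primes -/

/-- The radical of a saturation is the intersection of the primes which contain the equations and
none of the inequations. -/
theorem mem_radical_saturation_iff {R : Type*} [CommRing R] {A S : Set R} {f : R} :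
    f ∈ (saturation (Ideal.span A) S).radical ↔
      ∀ P : Ideal R, P.IsPrime → A ⊆ P → (∀ s ∈ S, s ∉ P) → f ∈ P := by
  constructor
  · rintro ⟨m, s, hs, hf⟩ P hP hA hS
    have hsP : s ∉ P := by
      have : Submonoid.closure S ≤ P.primeCompl := Submonoid.closure_le.2 hS
      exact this hs
    exact hP.mem_of_pow_mem m (((hP.mem_or_mem (Ideal.span_le.2 hA hf)).resolve_left hsP))
  · intro h
    by_contra hf
    -- If `f` is not in the radical, the ideal misses the monoid generated by `S` and `f`, and some
    -- prime over the ideal misses it too.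
    have hdisj : Disjoint (Ideal.span A : Set R)
        (Submonoid.closure S ⊔ Submonoid.closure {f} : Submonoid R) := by
      rw [Set.disjoint_right]
      rintro _ ht htA
      obtain ⟨s, hs, g, hg, rfl⟩ := Submonoid.mem_sup.1 ht
      obtain ⟨m, rfl⟩ := Submonoid.mem_closure_singleton.1 hg
      exact hf ⟨m, s, hs, htA⟩
    obtain ⟨P, hP, hle, hPd⟩ := Ideal.exists_le_prime_disjoint _ _ hdisj
    rw [Set.disjoint_right] at hPd
    refine hPd (Submonoid.mem_sup_right (Submonoid.mem_closure_singleton_self))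
      (h P hP (Ideal.subset_span.trans hle) fun s hs => ?_)
    exact hPd (Submonoid.mem_sup_left (Submonoid.subset_closure hs))

/-! ### Degrees of initials, tails and separants -/

theorem coeff_coeffIn (x : Fin n) (d : ℕ) (p : Poly n) (m : Fin n →₀ ℕ) :
    (coeffIn x d p).coeff m = if m x = 0 then p.coeff (m + Finsupp.single x d) else 0 := by
  classical
  have hm : ∀ m' : Fin n →₀ ℕ, m' x = d → m'.erase x = m → m' = m + Finsupp.single x d := by
    rintro m' rfl rfl
    exact (Finsupp.erase_add_single x m').symm
  rw [coeffIn, coeff_sum]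
  simp only [coeff_monomial]
  split_ifs with h
  · rw [Finset.sum_eq_single (m + Finsupp.single x d)]
    · rw [if_pos]
      rw [Finsupp.erase_add, Finsupp.erase_single, add_zero,
        Finsupp.erase_of_notMem_support (by simpa using h)]
    · intro m' hm' hne
      exact if_neg fun he => hne (hm m' (Finset.mem_filter.1 hm').2 he)
    · intro hne
      have : p.coeff (m + Finsupp.single x d) = 0 := by
        by_contra h0
        exact hne (Finset.mem_filter.2 ⟨mem_support_iff.2 h0, by simp [h]⟩)
      simp [this]
  · refine Finset.sum_eq_zero fun m' _ => if_neg ?_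
    rintro rfl
    exact h (Finsupp.erase_same)

theorem degreeOf_coeffIn_self (x : Fin n) (d : ℕ) (p : Poly n) :
    (coeffIn x d p).degreeOf x = 0 := by
  refine Nat.le_zero.1 (degreeOf_le_iff.2 fun m hm => ?_)
  rw [mem_support_iff, coeff_coeffIn] at hm
  by_contra h
  exact hm (if_neg (by omega))

theorem degreeOf_coeffIn_le (x y : Fin n) (d : ℕ) (p : Poly n) :
    (coeffIn x d p).degreeOf y ≤ p.degreeOf y := by
  refine degreeOf_le_iff.2 fun m hm => ?_
  rw [mem_support_iff, coeff_coeffIn] at hm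
  have h : p.coeff (m + Finsupp.single x d) ≠ 0 := fun h => hm (by simp [h])
  exact le_trans (by simp) (degreeOf_le_iff.1 le_rfl _ (mem_support_iff.2 h))

theorem initialIn_ne_zero (x : Fin n) {p : Poly n} (hp : p ≠ 0) : initialIn x p ≠ 0 := by
  obtain ⟨m, hm, hmd⟩ := Finset.exists_mem_eq_sup p.support (support_nonempty.2 hp) fun m => m x
  rw [← degreeOf_eq_sup] at hmd
  intro h0
  have h := coeff_coeffIn x (p.degreeOf x) p (m.erase x)
  rw [if_pos Finsupp.erase_same, hmd, Finsupp.erase_add_single, ← hmd] at h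
  rw [initialIn] at h0
  rw [h0, coeff_zero] at h
  exact mem_support_iff.1 hm h.symm

theorem initialIn_mul_add_tailIn (x : Fin n) (p : Poly n) :
    initialIn x p * X x ^ p.degreeOf x + tailIn x p = p := by
  rw [tailIn]; ring

/-- `p` and its top term agree on the monomials of top degree in `x`. Positive degree is needed
because zero has degree `0`. -/
theorem degreeOf_tailIn_lt {x : Fin n} {p : Poly n} (h : 0 < p.degreeOf x) :
    (tailIn x p).degreeOf x < p.degreeOf x := by
  have hdeg : (initialIn x p * X x ^ p.degreeOf x).degreeOf x ≤ p.degreeOf x := by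
    refine (degreeOf_mul_le _ _ _).trans ?_
    rw [initialIn, degreeOf_coeffIn_self, degreeOf_X_self_pow, zero_add]
  have key : ∀ m : Fin n →₀ ℕ, m x = p.degreeOf x →
      p.coeff m = (initialIn x p * X x ^ p.degreeOf x).coeff m := by
    intro m hm
    rw [X_pow_eq_monomial, coeff_mul_monomial', mul_one, if_pos (by simp [hm]), initialIn,
      coeff_coeffIn, if_pos (by simp [hm]), tsub_add_cancel_of_le (by simp [hm])]
  rw [tailIn]
  refine degreeOf_sub_lt h (fun m hm hle => key m ?_) fun m hm hle => key m ?_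
  · exact le_antisymm (degreeOf_le_iff.1 le_rfl m hm) hle
  · exact le_antisymm (degreeOf_le_iff.1 hdeg m hm) hle

/-- In characteristic zero the top exponent does not kill the top coefficient. For degree `0` the
subtraction truncates. -/
theorem degreeOf_separantIn (x : Fin n) (p : Poly n) :
    (separantIn x p).degreeOf x = p.degreeOf x - 1 := by
  refine le_antisymm (degreeOf_le_iff.2 fun m hm => ?_) ?_
  · rw [separantIn, mem_support_iff, coeff_pderiv] at hm
    have h := degreeOf_le_iff.1 (le_refl (p.degreeOf x)) _
      (mem_support_iff.2 (left_ne_zero_of_mul hm))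
    simp only [Finsupp.add_apply, Finsupp.single_eq_same] at h
    omega
  · rcases Nat.eq_zero_or_pos (p.degreeOf x) with h0 | h0
    · simp [h0]
    have hp : p ≠ 0 := by rintro rfl; simp at h0
    obtain ⟨m, hm, hmd⟩ := Finset.exists_mem_eq_sup p.support (support_nonempty.2 hp) fun m => m x
    rw [← degreeOf_eq_sup] at hmd
    have hmm : m - Finsupp.single x 1 + Finsupp.single x 1 = m :=
      tsub_add_cancel_of_le (by simp; omega)
    have hmem : m - Finsupp.single x 1 ∈ (separantIn x p).support := by
      rw [mem_support_iff, separantIn, coeff_pderiv, hmm]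
      exact mul_ne_zero (mem_support_iff.1 hm) (by positivity)
    have h := degreeOf_le_iff.1 (le_refl ((separantIn x p).degreeOf x)) _ hmem
    simpa [hmd] using h

theorem degreeOf_separantIn_le (x y : Fin n) (p : Poly n) :
    (separantIn x p).degreeOf y ≤ p.degreeOf y := by
  refine degreeOf_le_iff.2 fun m hm => ?_
  rw [separantIn, mem_support_iff, coeff_pderiv] at hm
  exact le_trans (by simp)
    (degreeOf_le_iff.1 le_rfl _ (mem_support_iff.2 (left_ne_zero_of_mul hm)))

/-- Hence a prime avoiding `i_q` also avoids the initial of `s_q`, and dividing by `s_q` calls for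
no further case distinction. -/
theorem initialIn_separantIn {x : Fin n} {p : Poly n} (h : 0 < p.degreeOf x) :
    initialIn x (separantIn x p) = C (p.degreeOf x : ℝ) * initialIn x p := by
  ext m
  rw [coeff_C_mul, initialIn, initialIn, degreeOf_separantIn, coeff_coeffIn, coeff_coeffIn]
  split_ifs with hm
  · rw [separantIn, coeff_pderiv, add_assoc, ← Finsupp.single_add, Nat.sub_add_cancel h, mul_comm]
    congr 1
    simp only [Finsupp.add_apply, hm, Finsupp.single_eq_same, zero_add]
    rw [Nat.cast_sub h]
    simp
  · simp

theorem separantIn_eq_initialIn {x : Fin n} {p : Poly n} (h : p.degreeOf x = 1) :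
    separantIn x p = initialIn x p := by
  ext m
  rw [initialIn, coeff_coeffIn, separantIn, coeff_pderiv, h]
  split_ifs with hm
  · simp [hm]
  · have : p.coeff (m + Finsupp.single x 1) = 0 := by
      by_contra h0
      have := degreeOf_le_iff.1 (le_refl (p.degreeOf x)) _ (mem_support_iff.2 h0)
      simp only [Finsupp.add_apply, Finsupp.single_eq_same] at this
      omega
    simp [this]

theorem IsLeader.ne_zero {p : Poly n} {x : Fin n} (h : IsLeader p x) : p ≠ 0 := by
  rintro rfl
  simpa using (isLeader_iff.1 h).1

theorem IsLeader.separantIn_ne_zero {p : Poly n} {x : Fin n} (h : IsLeader p x) :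
    separantIn x p ≠ 0 := by
  intro h0
  have hp := (isLeader_iff.1 h).1
  have hi := initialIn_separantIn hp
  rw [h0] at hi
  have hz : initialIn x (0 : Poly n) = 0 := by simp [initialIn, coeffIn]
  rw [hz, eq_comm, mul_eq_zero, C_eq_zero] at hi
  exact hi.elim (by positivity) (initialIn_ne_zero x h.ne_zero)

/-! ### Pseudodivision steps -/

/-- `f` involves no variable above `x`, and its degree in `x` is less than `d`. -/
def IsBelow (x : Fin n) (d : ℕ) (f : Poly n) : Prop :=
  f.degreeOf x < d ∧ ∀ y, x < y → f.degreeOf y = 0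

theorem IsLeader.isBelow_initialIn {p : Poly n} {x : Fin n} (h : IsLeader p x) :
    IsBelow x (p.degreeOf x) (initialIn x p) := by
  rw [isLeader_iff] at h
  refine ⟨?_, fun y hy => Nat.le_zero.1 ((degreeOf_coeffIn_le _ _ _ _).trans (h.2 y hy).le)⟩
  rw [initialIn, degreeOf_coeffIn_self]
  exact h.1

theorem IsLeader.isBelow_separantIn {p : Poly n} {x : Fin n} (h : IsLeader p x) :
    IsBelow x (p.degreeOf x) (separantIn x p) := by
  rw [isLeader_iff] at h
  refine ⟨?_, fun y hy => Nat.le_zero.1 ((degreeOf_separantIn_le x y p).trans (h.2 y hy).le)⟩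
  rw [degreeOf_separantIn]
  have := h.1
  omega

theorem IsBelow.mono {x : Fin n} {d e : ℕ} {f : Poly n} (h : IsBelow x d f) (hde : d ≤ e) :
    IsBelow x e f :=
  ⟨h.1.trans_le hde, h.2⟩

theorem IsBelow.sub {x : Fin n} {d : ℕ} {f g : Poly n} (hf : IsBelow x d f) (hg : IsBelow x d g) :
    IsBelow x d (f - g) := by
  refine ⟨(degreeOf_sub_le x f g).trans_lt (max_lt hf.1 hg.1), fun y hy => Nat.le_zero.1 ?_⟩
  refine (degreeOf_sub_le y f g).trans ?_
  simp [hf.2 y hy, hg.2 y hy]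

/-- Both bounds are strict, so `d + 1` stands for degree at most `d`. With `d = 0`, a factor free of
`x` leaves the bound unchanged. -/
theorem IsBelow.mul {x : Fin n} {d e : ℕ} {f g : Poly n} (hf : IsBelow x (d + 1) f)
    (hg : IsBelow x e g) : IsBelow x (d + e) (f * g) := by
  refine ⟨(degreeOf_mul_le x f g).trans_lt ?_, fun y hy => Nat.le_zero.1 ?_⟩
  · have := hf.1
    have := hg.1
    omega
  · refine (degreeOf_mul_le y f g).trans ?_
    simp [hf.2 y hy, hg.2 y hy]

theorem isBelow_X_pow (x : Fin n) (k : ℕ) : IsBelow x (k + 1) (X x ^ k : Poly n) := by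
  refine ⟨by simp, fun y hy => ?_⟩
  exact degreeOf_X_pow_of_ne k hy.ne'

theorem IsLeader.isBelow_tailIn {p : Poly n} {x : Fin n} (h : IsLeader p x) :
    IsBelow x (p.degreeOf x) (tailIn x p) := by
  refine ⟨degreeOf_tailIn_lt (isLeader_iff.1 h).1, ?_⟩
  have hp : IsBelow x (p.degreeOf x + 1) p := ⟨Nat.lt_succ_self _, (isLeader_iff.1 h).2⟩
  have hi : IsBelow x 1 (initialIn x p) :=
    ⟨by rw [initialIn, degreeOf_coeffIn_self]; exact one_pos, h.isBelow_initialIn.2⟩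
  exact (hp.sub ((hi.mul (isBelow_X_pow x _)).mono (by omega))).2

/-- Over a domain degrees add up in nonzero products. This controls `α` and `β`, which divide `i_q`
and `α * i_p`. -/
theorem IsBelow.of_dvd {x : Fin n} {d : ℕ} {f g : Poly n} (hg : IsBelow x d g) (h0 : g ≠ 0)
    (h : f ∣ g) : IsBelow x d f := by
  obtain ⟨k, rfl⟩ := h
  have hy : ∀ y, (f * k).degreeOf y = f.degreeOf y + k.degreeOf y := fun y =>
    degreeOf_mul_eq (left_ne_zero_of_mul h0) (right_ne_zero_of_mul h0)
  refine ⟨?_, fun y hxy => ?_⟩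
  · have := hg.1
    rw [hy] at this
    omega
  · have := hg.2 y hxy
    rw [hy] at this
    omega

theorem IsLeader.isBelow_one_initialIn {p : Poly n} {x : Fin n} (h : IsLeader p x) :
    IsBelow x 1 (initialIn x p) :=
  ⟨by rw [initialIn, degreeOf_coeffIn_self]; exact one_pos, h.isBelow_initialIn.2⟩

theorem PseudoStep.isBelow {p q r : Poly n} {x : Fin n} (h : PseudoStep p q r)
    (hp : IsLeader p x) (hq : IsLeader q x) : IsBelow x (p.degreeOf x) r := by
  obtain ⟨x', hx', hle, α, β, hα, hαβ, rfl⟩ := h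
  obtain rfl := hq.unique hx'
  have hiq := initialIn_ne_zero x hq.ne_zero
  have hip := initialIn_ne_zero x hp.ne_zero
  have hα0 : α ≠ 0 := ne_zero_of_dvd_ne_zero hiq hα
  have hαb : IsBelow x 1 α := hq.isBelow_one_initialIn.of_dvd hiq hα
  have hβb : IsBelow x 1 β :=
    ((IsBelow.mul (d := 0) hαb hp.isBelow_one_initialIn).mono (by simp)).of_dvd
      (mul_ne_zero hα0 hip) ⟨_, hαβ⟩
  -- The terms of top degree in `x` cancel by `α * i_p = β * i_q`, which leaves only the tails.
  have hr : α * p - β * X x ^ (p.degreeOf x - q.degreeOf x) * q =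
      α * tailIn x p - β * (X x ^ (p.degreeOf x - q.degreeOf x) * tailIn x q) := by
    have hX : (X x : Poly n) ^ p.degreeOf x =
        X x ^ (p.degreeOf x - q.degreeOf x) * X x ^ q.degreeOf x := by
      rw [← pow_add, Nat.sub_add_cancel hle]
    rw [tailIn, tailIn, hX]
    linear_combination X x ^ (p.degreeOf x - q.degreeOf x) * X x ^ q.degreeOf x * hαβ
  rw [hr]
  refine ((hαb.mul (d := 0) hp.isBelow_tailIn).mono (by simp)).sub
    ((hβb.mul (d := 0) ((isBelow_X_pow x _).mul hq.isBelow_tailIn)).mono (by omega))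

/-- Modulo `P`, `r` is `α * p`, and `α` is nonzero there as a factor of `i_q`. -/
theorem PseudoStep.mem_iff {p q r : Poly n} {x : Fin n} (h : PseudoStep p q r)
    (hq : IsLeader q x) {P : Ideal (Poly n)} (hP : P.IsPrime) (hqP : q ∈ P)
    (hi : initialIn x q ∉ P) : r ∈ P ↔ p ∈ P := by
  obtain ⟨x', hx', -, α, β, hα, -, rfl⟩ := h
  obtain rfl := hq.unique hx'
  have hαP : α ∉ P := fun h => hi (P.mem_of_dvd hα h)
  rw [Submodule.sub_mem_iff_left _ (P.mul_mem_left _ hqP)]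
  exact ⟨fun h => (hP.mem_or_mem h).resolve_left hαP, P.mul_mem_left α⟩

theorem exists_pseudoStep {p q : Poly n} {x : Fin n} (hq : IsLeader q x)
    (hle : q.degreeOf x ≤ p.degreeOf x) : ∃ r, PseudoStep p q r :=
  ⟨_, x, hq, hle, initialIn x q, initialIn x p, dvd_rfl, mul_comm _ _, rfl⟩

theorem IsLeader.isLeader_separantIn {p : Poly n} {x : Fin n} (h : IsLeader p x) (h1 : p.degreeOf x ≠ 1) :
    IsLeader (separantIn x p) x := by
  refine isLeader_iff.2 ⟨?_, h.isBelow_separantIn.2⟩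
  rw [degreeOf_separantIn]
  have := (isLeader_iff.1 h).1
  omega

/-- In degree one the separant is the initial, which was just added. Otherwise `s_q` still has
leader `x` and can serve as divisor. -/
theorem degreeOf_ne_one_of_not_contains {U : Subgroup ℝˣ} {S : Finset (Poly n)} {q : Poly n}
    {x : Fin n} (h : ¬ Contains U (hatIneqs S x q) (separantIn x q)) : q.degreeOf x ≠ 1 := by
  intro h1
  refine h ⟨1, U.one_mem, ?_⟩
  rw [separantIn_eq_initialIn h1, hatIneqs]
  simp

/-! ### Termination -/

/-- `y` is the leader of several elements of `A`, or of only one element and its separant is not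
in `S`. -/
def IsPending (U : Subgroup ℝˣ) (A S : Finset (Poly n)) (y : Fin n) : Prop :=
  IsShared A y ∨ ∃ q, IsLone A y q ∧ ¬ Contains U S (separantIn y q)

open Classical in
/-- The elements of `A` with leader `y`, weighted by their degrees in `y` such that an element
outweighs any two of lower degree. -/
noncomputable def weight (A : Finset (Poly n)) (y : Fin n) : ℕ :=
  ∑ p ∈ A with IsLeader p y, 3 ^ p.degreeOf y

open Classical in
/-- The quantity which decreases in every recursive call, when it is compared lexicographically
from the highest variable downwards. -/
noncomputable def measureAt (U : Subgroup ℝˣ) (P : System n) (y : Fin n) : ℕ :=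
  2 * weight P.1 y + if IsPending U P.1 P.2 y then 1 else 0

theorem Contains.mono {U : Subgroup ℝˣ} {S S' : Finset (Poly n)} {f : Poly n}
    (h : Contains U S f) (hS : S ⊆ S') : Contains U S' f := by
  obtain ⟨u, hu, hf⟩ := h
  exact ⟨u, hu, hS hf⟩

theorem weight_congr {A A' : Finset (Poly n)} {y : Fin n}
    (h : ∀ f, IsLeader f y → (f ∈ A' ↔ f ∈ A)) : weight A' y = weight A y := by
  unfold weight
  congr 1
  ext f
  simp only [Finset.mem_filter]
  exact and_congr_left (h f)

/-- More inequations can settle a variable but never make one pending. -/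
theorem IsPending.of_congr {U : Subgroup ℝˣ} {A A' S S' : Finset (Poly n)} {y : Fin n}
    (h : ∀ f, IsLeader f y → (f ∈ A' ↔ f ∈ A)) (hS : S ⊆ S') (hp : IsPending U A' S' y) :
    IsPending U A S y := by
  rcases hp with ⟨p, hp, q, hq, hne, hpy, hqy⟩ | ⟨q, ⟨hq, hqy, hu⟩, hc⟩
  · exact Or.inl ⟨p, (h p hpy).1 hp, q, (h q hqy).1 hq, hne, hpy, hqy⟩
  · exact Or.inr ⟨q, ⟨(h q hqy).1 hq, hqy, fun p hp hpy => hu p ((h p hpy).2 hp) hpy⟩,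
      fun hc' => hc (hc'.mono hS)⟩

/-- `A'` arises from `A` when `p`, which has leader `x`, is replaced by at most two polynomials of
lower degree in `x` and without variables above `x`. -/
structure Replaces (A A' : Finset (Poly n)) (x : Fin n) (p : Poly n) : Prop where
  mem : p ∈ A
  isLeader : IsLeader p x
  kept : ∀ f ∈ A, f ≠ p → f ∈ A'
  added : ∃ N : Finset (Poly n), N.card ≤ 2 ∧ (∀ f ∈ N, IsBelow x (p.degreeOf x) f) ∧
    ∀ f ∈ A', (f ∈ A ∧ f ≠ p) ∨ f ∈ N

theorem IsBelow.not_isLeader {x y : Fin n} {d : ℕ} {f : Poly n} (h : IsBelow x d f)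
    (hxy : x < y) : ¬ IsLeader f y := fun hy => (isLeader_iff.1 hy).1.ne' (h.2 y hxy)

theorem Replaces.mem_iff {A A' : Finset (Poly n)} {x y : Fin n} {p : Poly n}
    (h : Replaces A A' x p) (hxy : x < y) (f : Poly n) (hf : IsLeader f y) :
    f ∈ A' ↔ f ∈ A := by
  obtain ⟨N, -, hN, hA'⟩ := h.added
  refine ⟨fun hfA => ?_, fun hfA => h.kept f hfA ?_⟩
  · exact (hA' f hfA).elim And.left fun hfN => ((hN f hfN).not_isLeader hxy hf).elim
  · rintro rfl
    exact hxy.ne (h.isLeader.unique hf)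

theorem Replaces.weight_lt {A A' : Finset (Poly n)} {x : Fin n} {p : Poly n}
    (h : Replaces A A' x p) : weight A' x < weight A x := by
  classical
  obtain ⟨N, hcard, hN, hA'⟩ := h.added
  have hpos := (isLeader_iff.1 h.isLeader).1
  -- `N` may contain elements without leader `x`; counting them too only enlarges the upper bound.
  have hsub : A'.filter (IsLeader · x) ⊆ ((A.filter (IsLeader · x)).erase p) ∪ N := by
    intro f hf
    obtain ⟨hfA, hfx⟩ := Finset.mem_filter.1 hf
    rw [Finset.mem_union, Finset.mem_erase, Finset.mem_filter]
    exact (hA' f hfA).imp (fun hf' => ⟨hf'.2, hf'.1, hfx⟩) id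
  have hNsum : ∑ f ∈ N, 3 ^ f.degreeOf x < 3 ^ p.degreeOf x := by
    calc ∑ f ∈ N, 3 ^ f.degreeOf x ≤ N.card • 3 ^ (p.degreeOf x - 1) :=
          Finset.sum_le_card_nsmul _ _ _ fun f hf =>
            Nat.pow_le_pow_right (by norm_num) (by have := (hN f hf).1; omega)
      _ ≤ 2 * 3 ^ (p.degreeOf x - 1) := Nat.mul_le_mul_right _ hcard
      _ < 3 * 3 ^ (p.degreeOf x - 1) := by
          have : 0 < 3 ^ (p.degreeOf x - 1) := by positivity
          omega
      _ = 3 ^ p.degreeOf x := by rw [← pow_succ', Nat.sub_add_cancel hpos]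
  have hp : p ∈ A.filter (IsLeader · x) := Finset.mem_filter.2 ⟨h.mem, h.isLeader⟩
  have hle : ∑ f ∈ A'.filter (IsLeader · x), 3 ^ f.degreeOf x ≤
      ∑ f ∈ (A.filter (IsLeader · x)).erase p, 3 ^ f.degreeOf x + ∑ f ∈ N, 3 ^ f.degreeOf x := by
    rw [← Finset.sum_union_inter]
    exact (Finset.sum_le_sum_of_subset hsub).trans (Nat.le_add_right _ _)
  have hsum := Finset.sum_erase_add _ (fun f => 3 ^ f.degreeOf x) hp
  unfold weight
  convert (by omega : ∑ f ∈ A'.filter (IsLeader · x), 3 ^ f.degreeOf x <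
    ∑ f ∈ A.filter (IsLeader · x), 3 ^ f.degreeOf x)

/-- The lexicographic order on the measures, with the highest variable first. -/
def MeasureLT (U : Subgroup ℝˣ) (Q P : System n) : Prop :=
  Pi.Lex (· > ·) (fun {_} => (· < ·)) (measureAt U Q) (measureAt U P)

/-- The lexicographic order is well founded because there are finitely many variables. -/
theorem wellFounded_measureLT (U : Subgroup ℝˣ) :
    WellFounded (MeasureLT U : System n → System n → Prop) :=
  InvImage.wf _ (Pi.Lex.wellFounded _ fun _ => wellFounded_lt)

/-- No variable above the target is pending, before or after the call, so only the weight counts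
there. -/
theorem measureAt_eq_of_lt {U : Subgroup ℝˣ} {A A' S S' : Finset (Poly n)} {x y : Fin n}
    (hx : IsTarget U A S x) (hxy : x < y) (h : ∀ f, IsLeader f y → (f ∈ A' ↔ f ∈ A))
    (hS : S ⊆ S') : measureAt U (A', S') y = measureAt U (A, S) y := by
  have hn : ¬ IsPending U A S y := fun hp => not_le.2 hxy (hx.2 hp)
  have hn' : ¬ IsPending U A' S' y := fun hp => hn (hp.of_congr h hS)
  simp only [measureAt, weight_congr h, if_neg hn, if_neg hn']

theorem Replaces.measureLT {U : Subgroup ℝˣ} {A A' S S' : Finset (Poly n)} {x : Fin n}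
    {p : Poly n} (h : Replaces A A' x p) (hx : IsTarget U A S x) (hS : S ⊆ S') :
    MeasureLT U (A', S') (A, S) := by
  refine ⟨x, fun y hy => measureAt_eq_of_lt hx hy (h.mem_iff hy) hS, ?_⟩
  -- Because of the factor `2`, a drop in weight wins even if `x` becomes pending.
  have := h.weight_lt
  simp only [measureAt]
  split_ifs <;> omega

/-- The equations, hence the weights, are unchanged; the decrease is that `x` is no longer pending.
-/
theorem measureLT_of_contains {U : Subgroup ℝˣ} {A S S' : Finset (Poly n)} {x : Fin n}
    {q : Poly n} (hx : IsTarget U A S x) (hq : IsLone A x q) (hS : S ⊆ S')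
    (hc : Contains U S' (separantIn x q)) : MeasureLT U (A, S') (A, S) := by
  refine ⟨x, fun y hy => measureAt_eq_of_lt hx hy (fun _ _ => Iff.rfl) hS, ?_⟩
  have hn : ¬ IsPending U A S' x := by
    rintro (⟨p, hp, p', hp', hne, hpx, hpx'⟩ | ⟨q', hq', hc'⟩)
    · exact hne ((hq.2.2 p hp hpx).trans (hq.2.2 p' hp' hpx').symm)
    · rw [hq.2.2 q' hq'.1 hq'.2.1] at hc'
      exact hc' hc
  have hp : IsPending U A S x := hx.1
  simp only [measureAt, if_neg hn, if_pos hp]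
  omega

theorem replaces_tildeEqs {A : Finset (Poly n)} {x : Fin n} {q : Poly n} (hq : q ∈ A)
    (hx : IsLeader q x) : Replaces A (tildeEqs A x q) x q := by
  classical
  refine ⟨hq, hx, fun f hf hne => by simp [tildeEqs, hf, hne],
    {initialIn x q, tailIn x q}, Finset.card_le_two, ?_, ?_⟩
  · simp only [Finset.mem_insert, Finset.mem_singleton]
    rintro f (rfl | rfl)
    exacts [hx.isBelow_initialIn, hx.isBelow_tailIn]
  · intro f hf
    simp only [tildeEqs, Finset.mem_sdiff, Finset.mem_union, Finset.mem_singleton] at hf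
    exact hf.1.imp (fun h => ⟨h, hf.2⟩) id

theorem replaces_sdiff {A N : Finset (Poly n)} {x : Fin n} {p : Poly n} (hp : p ∈ A)
    (hx : IsLeader p x) (hcard : N.card ≤ 2) (hN : ∀ f ∈ N, IsBelow x (p.degreeOf x) f) :
    Replaces A ((A ∪ N) \ {p}) x p := by
  refine ⟨hp, hx, fun f hf hne => by simp [hf, hne], N, hcard, hN, fun f hf => ?_⟩
  simp only [Finset.mem_sdiff, Finset.mem_union, Finset.mem_singleton] at hf
  exact hf.1.imp (fun h => ⟨h, hf.2⟩) id

theorem replaces_dividend {A : Finset (Poly n)} {x : Fin n} {q p r : Poly n}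
    (hq : IsDivisor A x q) (hp : IsDividend A x q p) (h : PseudoStep p q r) :
    Replaces A ((A ∪ {r}) \ {p}) x p :=
  replaces_sdiff hp.1 hp.2.2.1 (by simp) (by simpa using h.isBelow hp.2.2.1 hq.2.1)

theorem subset_hatIneqs (S : Finset (Poly n)) (x : Fin n) (q : Poly n) : S ⊆ hatIneqs S x q :=
  Finset.subset_union_left

theorem contains_union_self {U : Subgroup ℝˣ} (S : Finset (Poly n)) (f : Poly n) :
    Contains U (S ∪ {f}) f :=
  ⟨1, U.one_mem, by simp⟩

theorem Calls.measureLT {U : Subgroup ℝˣ} {P Q : System n} (h : Calls U P Q) :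
    MeasureLT U Q P := by
  classical
  obtain ⟨L, hL, hQ⟩ := h
  cases hL with
  | @shared A S x q p r target divisor shared dividend step =>
    simp only [List.mem_cons, List.not_mem_nil, or_false] at hQ
    have hr := replaces_dividend divisor dividend step
    rcases hQ with rfl | rfl | rfl
    · exact (replaces_tildeEqs divisor.1 divisor.2.1).measureLT target subset_rfl
    -- `r` and `s_q` jointly replace `p`: the degree of `s_q` is below that of `q`, which is at most
    -- that of `p` since `q` has minimal degree.
    · refine Replaces.measureLT (p := p) ⟨dividend.1, dividend.2.2.1, fun f hf hne => ?_,
        {r, separantIn x q}, Finset.card_le_two, ?_, ?_⟩ target (subset_hatIneqs _ _ _)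
      · exact Finset.mem_union_left _ (hr.kept f hf hne)
      · simp only [Finset.mem_insert, Finset.mem_singleton]
        rintro f (rfl | rfl)
        · exact step.isBelow dividend.2.2.1 divisor.2.1
        · exact divisor.2.1.isBelow_separantIn.mono
            (divisor.2.2.1 _ dividend.1 dividend.2.2.1)
      · intro f hf
        simp only [Finset.mem_union, Finset.mem_sdiff, Finset.mem_singleton] at hf
        simp only [Finset.mem_insert, Finset.mem_singleton]
        tauto
    · exact hr.measureLT target ((subset_hatIneqs _ _ _).trans Finset.subset_union_left)
  | @loneMem A S x q target divisor lone mem =>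
    simp only [List.mem_cons, List.not_mem_nil, or_false] at hQ
    rcases hQ with rfl | rfl
    · exact (replaces_tildeEqs divisor.1 divisor.2.1).measureLT target subset_rfl
    · exact measureLT_of_contains target lone (subset_hatIneqs _ _ _) mem
  | @loneNotMem A S x q r target divisor lone notMem step =>
    simp only [List.mem_cons, List.not_mem_nil, or_false] at hQ
    have hs := divisor.2.1.isLeader_separantIn (degreeOf_ne_one_of_not_contains notMem)
    rcases hQ with rfl | rfl | rfl
    · exact (replaces_tildeEqs divisor.1 divisor.2.1).measureLT target subset_rfl
    · refine (replaces_sdiff divisor.1 divisor.2.1 Finset.card_le_two ?_).measureLT target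
        (subset_hatIneqs _ _ _)
      simp only [Finset.mem_insert, Finset.mem_singleton]
      rintro f (rfl | rfl)
      exacts [divisor.2.1.isBelow_separantIn, step.isBelow divisor.2.1 hs]
    · exact measureLT_of_contains target lone
        ((subset_hatIneqs _ _ _).trans Finset.subset_union_left) (contains_union_self _ _)

theorem wellFounded_calls (n : ℕ) (U : Subgroup ℝˣ) :
    WellFounded fun Q P : System n => Calls U P Q :=
  Subrelation.wf Calls.measureLT (wellFounded_measureLT U)

/-! ### Existence of complete executions -/

theorem exists_isTarget {U : Subgroup ℝˣ} {A S : Finset (Poly n)}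
    (h : ¬ (IsTriangular A ∧ HasSeparants U A S)) : ∃ x, IsTarget U A S x := by
  have hne : {y | IsPending U A S y}.Nonempty := by
    by_contra hemp
    have hn : ∀ y, ¬ IsPending U A S y := fun y hy => hemp ⟨y, hy⟩
    have htri : IsTriangular A := fun p hp q hq x hpx hqx =>
      by_contra fun hpq => hn x (Or.inl ⟨p, hp, q, hq, hpq, hpx, hqx⟩)
    exact h ⟨htri, fun q hq x hx => by_contra fun hc =>
      hn x (Or.inr ⟨q, ⟨hq, hx, fun p hp hpx => htri p hp q hq x hpx hx⟩, hc⟩)⟩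
  obtain ⟨x, hx, hmax⟩ := (Set.toFinite _).exists_maximal hne
  exact ⟨x, hx, fun y hy => le_of_not_gt fun hlt => (hmax hy hlt.le).not_gt hlt⟩

theorem exists_isDivisor {A : Finset (Poly n)} {x : Fin n} (h : ∃ f ∈ A, IsLeader f x) :
    ∃ q, IsDivisor A x q := by
  classical
  obtain ⟨f, hf, hfx⟩ := h
  -- A lexicographic minimum of degree in `x` and total degree meets both conditions on a divisor.
  obtain ⟨q, hq, hmin⟩ := (A.filter (IsLeader · x)).exists_min_image
    (fun f => toLex (f.degreeOf x, f.totalDegree)) ⟨f, Finset.mem_filter.2 ⟨hf, hfx⟩⟩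
  rw [Finset.mem_filter] at hq
  simp only [Finset.mem_filter, and_imp, Prod.Lex.toLex_le_toLex] at hmin
  refine ⟨q, hq.1, hq.2, fun f hf hfx => ?_, fun f hf hfx he => ?_⟩ <;>
  · have := hmin f hf hfx
    omega

theorem exists_isDividend {A : Finset (Poly n)} {x : Fin n} {q : Poly n} (hq : IsDivisor A x q)
    (h : IsShared A x) : ∃ p, IsDividend A x q p := by
  classical
  have hne : ((A.erase q).filter (IsLeader · x)).Nonempty := by
    obtain ⟨f, hf, g, hg, hfg, hfx, hgx⟩ := h
    by_cases hfq : f = q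
    · exact ⟨g, by simp [hg, hgx, ← hfq, hfg.symm]⟩
    · exact ⟨f, by simp [hf, hfx, hfq]⟩
  obtain ⟨p, hp, hmax⟩ := Finset.exists_max_image _
    (fun f => toLex (f.degreeOf x, f.totalDegree)) hne
  simp only [Finset.mem_filter, Finset.mem_erase] at hp
  simp only [Finset.mem_filter, Finset.mem_erase, and_imp, Prod.Lex.toLex_le_toLex] at hmax
  refine ⟨p, hp.1.2, hp.1.1, hp.2, fun f hf hfx => ?_, fun f hf hfq hfx he => ?_⟩
  -- The maximum was taken without `q`, but `q` has minimal degree in `x`, so it cannot exceed `p`.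
  · by_cases hfq : f = q
    · exact hfq ▸ hq.2.2.1 p hp.1.2 hp.2
    · have := hmax f hfq hf hfx
      omega
  · have := hmax f hfq hf hfx
    omega

theorem exists_body {U : Subgroup ℝˣ} {A S : Finset (Poly n)}
    (h : ¬ (IsTriangular A ∧ HasSeparants U A S)) : ∃ L, Body U (A, S) L := by
  obtain ⟨x, hx⟩ := exists_isTarget h
  by_cases hsh : IsShared A x
  · obtain ⟨q, hq⟩ : ∃ q, IsDivisor A x q := by
      obtain ⟨f, hf, -, -, -, hfx, -⟩ := hsh
      exact exists_isDivisor ⟨f, hf, hfx⟩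
    obtain ⟨p, hp⟩ := exists_isDividend hq hsh
    obtain ⟨r, hr⟩ := exists_pseudoStep hq.2.1 (hq.2.2.1 p hp.1 hp.2.2.1)
    exact ⟨_, .shared hx hq hsh hp hr⟩
  · obtain ⟨q, hlone, -⟩ := hx.1.resolve_left hsh
    have hq : IsDivisor A x q := ⟨hlone.1, hlone.2.1,
      fun f hf hfx => (hlone.2.2 f hf hfx) ▸ le_rfl,
      fun f hf hfx _ => (hlone.2.2 f hf hfx) ▸ le_rfl⟩
    by_cases hc : Contains U (hatIneqs S x q) (separantIn x q)
    · exact ⟨_, .loneMem hx hq hlone hc⟩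
    · obtain ⟨r, hr⟩ := exists_pseudoStep (p := q)
        (hq.2.1.isLeader_separantIn (degreeOf_ne_one_of_not_contains hc))
        (by rw [degreeOf_separantIn]; omega)
      exact ⟨_, .loneNotMem hx hq hlone hc hr⟩

theorem exists_returns (U : Subgroup ℝˣ) (P : System n) : ∃ O, Returns U P O := by
  induction P using (wellFounded_calls n U).induction with
  | _ P ih =>
    obtain ⟨A, S⟩ := P
    by_cases h : IsTriangular A ∧ HasSeparants U A S
    · exact ⟨_, .done h.1 h.2⟩
    · obtain ⟨L, hL⟩ := exists_body h
      choose O hO using fun i : Fin L.length => ih (L.get i) ⟨L, hL, L.get_mem i⟩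
      exact ⟨_, .split hL O hO⟩

/-! ### Correctness -/

/-- The prime ideals that contain the equations and none of the inequations of `P`. -/
def IsZero (P : System n) (𝔭 : Ideal (Poly n)) : Prop :=
  𝔭.IsPrime ∧ (P.1 : Set (Poly n)) ⊆ 𝔭 ∧ ∀ s ∈ P.2, s ∉ 𝔭

theorem IsBelow.ne {x : Fin n} {p f : Poly n} (h : IsBelow x (p.degreeOf x) f) : f ≠ p := by
  rintro rfl
  exact h.1.false

theorem Replaces.subset {A A' : Finset (Poly n)} {x : Fin n} {p : Poly n}
    (h : Replaces A A' x p) {𝔭 : Ideal (Poly n)} (hA' : (A' : Set (Poly n)) ⊆ 𝔭) (hp : p ∈ 𝔭) :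
    (A : Set (Poly n)) ⊆ 𝔭 := by
  intro f hf
  by_cases hfp : f = p
  · exact hfp ▸ hp
  · exact hA' (h.kept f hf hfp)

/-- Given `i_q ∈ 𝔭`, the decomposition `q = i_q * x ^ d + tail` makes `q` and its tail equivalent
modulo `𝔭`. -/
theorem isZero_tildeEqs_iff {A S : Finset (Poly n)} {x : Fin n} {q : Poly n} (hq : q ∈ A)
    (hx : IsLeader q x) {𝔭 : Ideal (Poly n)} :
    IsZero (tildeEqs A x q, S) 𝔭 ↔ IsZero (A, S) 𝔭 ∧ initialIn x q ∈ 𝔭 := by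
  have hrep := replaces_tildeEqs hq hx
  constructor
  · rintro ⟨hP, hA, hS⟩
    -- The initial and the tail survive the removal of `q`, since they have lower degree in `x`.
    have hi : initialIn x q ∈ 𝔭 := hA (by simp [tildeEqs, hx.isBelow_initialIn.ne])
    have ht : tailIn x q ∈ 𝔭 := hA (by simp [tildeEqs, hx.isBelow_tailIn.ne])
    refine ⟨⟨hP, hrep.subset hA ?_, hS⟩, hi⟩
    rw [← initialIn_mul_add_tailIn x q]
    exact 𝔭.add_mem (𝔭.mul_mem_right _ hi) ht
  · rintro ⟨⟨hP, hA, hS⟩, hi⟩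
    refine ⟨hP, fun f hf => ?_, hS⟩
    simp only [tildeEqs, Finset.coe_sdiff, Finset.coe_union, Finset.coe_insert,
      Finset.coe_singleton, Set.mem_sdiff, Set.mem_union, Set.mem_insert_iff,
      Set.mem_singleton_iff] at hf
    rcases hf.1 with hf | rfl | rfl
    · exact hA hf
    · exact hi
    · exact 𝔭.sub_mem (hA hq) (𝔭.mul_mem_right _ hi)

/-- The first branch collects the primes with `i_q ∈ 𝔭`, the others those with `i_q ∉ 𝔭`. If there
are three, the second has `s_q ∈ 𝔭` and the third `s_q ∉ 𝔭`. -/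
theorem Body.isZero_iff {U : Subgroup ℝˣ} {P : System n} {L : List (System n)} (h : Body U P L)
    (𝔭 : Ideal (Poly n)) : IsZero P 𝔭 ↔ ∃ Q ∈ L, IsZero Q 𝔭 := by
  cases h with
  | @shared A S x q p r target divisor shared dividend step =>
    simp only [List.mem_cons, List.not_mem_nil, or_false, exists_eq_or_imp, exists_eq_left,
      isZero_tildeEqs_iff divisor.1 divisor.2.1]
    have hrep := replaces_dividend divisor dividend step
    have hrp : r ≠ p := (step.isBelow dividend.2.2.1 divisor.2.1).ne
    constructor
    · rintro ⟨hP, hA, hS⟩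
      by_cases hi : initialIn x q ∈ 𝔭
      · exact Or.inl ⟨⟨hP, hA, hS⟩, hi⟩
      have hr := (step.mem_iff divisor.2.1 hP (hA divisor.1) hi).2 (hA dividend.1)
      by_cases hs : separantIn x q ∈ 𝔭
      · refine Or.inr (Or.inl ⟨hP, ?_, ?_⟩)
        · intro f hf
          simp only [Finset.mem_coe, Finset.mem_union, Finset.mem_sdiff,
            Finset.mem_singleton] at hf
          rcases hf with ⟨hf | rfl, -⟩ | rfl
          exacts [hA hf, hr, hs]
        · intro s hs'
          simp only [hatIneqs, Finset.mem_union, Finset.mem_singleton] at hs'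
          rcases hs' with hs' | rfl
          exacts [hS s hs', hi]
      · refine Or.inr (Or.inr ⟨hP, ?_, ?_⟩)
        · intro f hf
          simp only [Finset.mem_coe, Finset.mem_union, Finset.mem_sdiff,
            Finset.mem_singleton] at hf
          rcases hf with ⟨hf | rfl, -⟩
          exacts [hA hf, hr]
        · intro s hs'
          simp only [hatIneqs, Finset.mem_union, Finset.mem_singleton] at hs'
          rcases hs' with (hs' | rfl) | rfl
          exacts [hS s hs', hi, hs]
    -- This is common to the second and third branch: `q ≠ p` is kept, so `r ∈ 𝔭` gives back `p ∈
    -- 𝔭`.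
    · have key : 𝔭.IsPrime → (((A ∪ {r}) \ {p} : Finset (Poly n)) : Set (Poly n)) ⊆ 𝔭 →
          (∀ s ∈ hatIneqs S x q, s ∉ 𝔭) → IsZero (A, S) 𝔭 := by
        intro hP hA hS
        have hq : q ∈ 𝔭 := hA (hrep.kept q divisor.1 dividend.2.1.symm)
        have hr : r ∈ 𝔭 := hA (by simp [hrp])
        have hi : initialIn x q ∉ 𝔭 := hS _ (by simp [hatIneqs])
        exact ⟨hP, hrep.subset hA ((step.mem_iff divisor.2.1 hP hq hi).1 hr),
          fun s hs => hS s (subset_hatIneqs _ _ _ hs)⟩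
      rintro (h | ⟨hP, hA, hS⟩ | ⟨hP, hA, hS⟩)
      · exact h.1
      · exact key hP (fun f hf => hA (Finset.mem_union_left _ hf)) hS
      · exact key hP hA fun s hs => hS s (Finset.mem_union_left _ hs)
  | @loneMem A S x q target divisor lone mem =>
    simp only [List.mem_cons, List.not_mem_nil, or_false, exists_eq_or_imp, exists_eq_left,
      isZero_tildeEqs_iff divisor.1 divisor.2.1]
    constructor
    · rintro ⟨hP, hA, hS⟩
      by_cases hi : initialIn x q ∈ 𝔭
      · exact Or.inl ⟨⟨hP, hA, hS⟩, hi⟩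
      · refine Or.inr ⟨hP, hA, fun s hs => ?_⟩
        simp only [hatIneqs, Finset.mem_union, Finset.mem_singleton] at hs
        rcases hs with hs | rfl
        exacts [hS s hs, hi]
    · rintro (h | ⟨hP, hA, hS⟩)
      · exact h.1
      · exact ⟨hP, hA, fun s hs => hS s (subset_hatIneqs _ _ _ hs)⟩
  | @loneNotMem A S x q r target divisor lone notMem step =>
    simp only [List.mem_cons, List.not_mem_nil, or_false, exists_eq_or_imp, exists_eq_left,
      isZero_tildeEqs_iff divisor.1 divisor.2.1]
    have hqx := divisor.2.1
    have hsx := hqx.isLeader_separantIn (degreeOf_ne_one_of_not_contains notMem)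
    have hdeg := (isLeader_iff.1 hqx).1
    have hbr := step.isBelow hqx hsx
    -- The initial of the divisor `s_q` is `i_q` times the degree, a unit, so `i_q ∉ 𝔭` suffices.
    have hmem : ∀ {𝔭 : Ideal (Poly n)}, 𝔭.IsPrime → initialIn x q ∉ 𝔭 → separantIn x q ∈ 𝔭 →
        (r ∈ 𝔭 ↔ q ∈ 𝔭) := by
      intro 𝔭 hP hi hs
      refine step.mem_iff hsx hP hs fun his => ?_
      rw [initialIn_separantIn hdeg] at his
      refine (hP.mem_or_mem his).elim (fun hC => hP.ne_top ?_) hi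
      exact 𝔭.eq_top_of_isUnit_mem hC
        ((isUnit_iff_ne_zero.2 (by positivity : (q.degreeOf x : ℝ) ≠ 0)).map C)
    constructor
    · rintro ⟨hP, hA, hS⟩
      by_cases hi : initialIn x q ∈ 𝔭
      · exact Or.inl ⟨⟨hP, hA, hS⟩, hi⟩
      by_cases hs : separantIn x q ∈ 𝔭
      · refine Or.inr (Or.inl ⟨hP, ?_, ?_⟩)
        · intro f hf
          simp only [Finset.mem_coe, Finset.mem_union, Finset.mem_sdiff, Finset.mem_insert,
            Finset.mem_singleton] at hf
          rcases hf with ⟨hf | rfl | rfl, -⟩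
          exacts [hA hf, hs, (hmem hP hi hs).2 (hA divisor.1)]
        · intro s hs'
          simp only [hatIneqs, Finset.mem_union, Finset.mem_singleton] at hs'
          rcases hs' with hs' | rfl
          exacts [hS s hs', hi]
      · refine Or.inr (Or.inr ⟨hP, hA, fun s hs' => ?_⟩)
        simp only [hatIneqs, Finset.mem_union, Finset.mem_singleton] at hs'
        rcases hs' with (hs' | rfl) | rfl
        exacts [hS s hs', hi, hs]
    · rintro (h | ⟨hP, hA, hS⟩ | ⟨hP, hA, hS⟩)
      · exact h.1
      · have hr : r ∈ 𝔭 := hA (by simp [hbr.ne])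
        have hs : separantIn x q ∈ 𝔭 := hA (by simp [hqx.isBelow_separantIn.ne])
        have hi : initialIn x q ∉ 𝔭 := hS _ (by simp [hatIneqs])
        have hq := (hmem hP hi hs).1 hr
        refine ⟨hP, fun f hf => ?_, fun s hs => hS s (subset_hatIneqs _ _ _ hs)⟩
        by_cases hfq : f = q
        · exact hfq ▸ hq
        · exact hA (by simp [Finset.mem_coe.1 hf, hfq])
      · exact ⟨hP, hA, fun s hs => hS s (Finset.mem_union_left _ (subset_hatIneqs _ _ _ hs))⟩

theorem zero_notMem_union_singleton {S : Finset (Poly n)} {f : Poly n} (hS : 0 ∉ S)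
    (hf : f ≠ 0) : 0 ∉ S ∪ {f} := by
  simp [hS, hf.symm]

theorem Body.zero_notMem {U : Subgroup ℝˣ} {P : System n} {L : List (System n)} (h : Body U P L)
    (hP : 0 ∉ P.2) : ∀ Q ∈ L, 0 ∉ Q.2 := by
  have hhat : ∀ {S : Finset (Poly n)} {x q}, 0 ∉ S → IsLeader q x → 0 ∉ hatIneqs S x q :=
    fun hS hq => zero_notMem_union_singleton hS (initialIn_ne_zero _ hq.ne_zero)
  intro Q hQ
  cases h with
  | shared target divisor shared dividend step =>
    simp only [List.mem_cons, List.not_mem_nil, or_false] at hQ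
    rcases hQ with rfl | rfl | rfl
    exacts [hP, hhat hP divisor.2.1,
      zero_notMem_union_singleton (hhat hP divisor.2.1) divisor.2.1.separantIn_ne_zero]
  | loneMem target divisor lone mem =>
    simp only [List.mem_cons, List.not_mem_nil, or_false] at hQ
    rcases hQ with rfl | rfl
    exacts [hP, hhat hP divisor.2.1]
  | loneNotMem target divisor lone notMem step =>
    simp only [List.mem_cons, List.not_mem_nil, or_false] at hQ
    rcases hQ with rfl | rfl | rfl
    exacts [hP, hhat hP divisor.2.1,
      zero_notMem_union_singleton (hhat hP divisor.2.1) divisor.2.1.separantIn_ne_zero]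

theorem mem_radical_saturation_iff_isZero {P : System n} {f : Poly n} :
    f ∈ (saturation (Ideal.span (P.1 : Set (Poly n))) (P.2 : Set (Poly n))).radical ↔
      ∀ 𝔭, IsZero P 𝔭 → f ∈ 𝔭 := by
  simp only [mem_radical_saturation_iff, IsZero, and_imp, Finset.mem_coe]

/-- Every output consists of regular systems, and decomposes the radical of the saturation. -/
theorem Returns.correct {U : Subgroup ℝˣ} {P : System n} {O : Finset (System n)}
    (h : Returns U P O) (h0 : 0 ∉ P.2) :
    (∀ Q ∈ O, IsRegularSystem U Q.1 Q.2) ∧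
      (saturation (Ideal.span (P.1 : Set (Poly n))) (P.2 : Set (Poly n))).radical =
        ⨅ Q ∈ O, saturation (Ideal.span (Q.1 : Set (Poly n))) (Q.2 : Set (Poly n)) := by
  induction h with
  | @done A S htri hsep =>
    simp only [Finset.mem_singleton, forall_eq, iInf_iInf_eq_left]
    exact ⟨⟨h0, htri, hsep⟩, (isRadical_saturation htri hsep).radical⟩
  | @split P L body O _ ih =>
    have ih' := fun i => ih i (body.zero_notMem h0 _ (L.get_mem i))
    refine ⟨fun Q hQ => ?_, ?_⟩
    · obtain ⟨i, -, hQi⟩ := Finset.mem_biUnion.1 hQ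
      exact (ih' i).1 Q hQi
    · ext f
      -- The primes of `P` are the union of those of its calls, so lying in all of them can be
      -- tested call by call, where the induction hypothesis applies.
      have hi : ∀ i, (∀ 𝔭, IsZero (L.get i) 𝔭 → f ∈ 𝔭) ↔ ∀ Q ∈ O i,
          f ∈ saturation (Ideal.span (Q.1 : Set (Poly n))) (Q.2 : Set (Poly n)) := by
        intro i
        rw [← mem_radical_saturation_iff_isZero, (ih' i).2]
        simp only [Ideal.mem_iInf]
      simp only [mem_radical_saturation_iff_isZero, body.isZero_iff, Ideal.mem_iInf,
        Finset.mem_biUnion, Finset.mem_univ, true_and]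
      constructor
      · rintro h Q ⟨i, hQ⟩
        exact (hi i).1 (fun 𝔭 h𝔭 => h 𝔭 ⟨_, L.get_mem i, h𝔭⟩) Q hQ
      · rintro h 𝔭 ⟨Q, hQ, h𝔭⟩
        obtain ⟨i, rfl⟩ := List.get_of_mem hQ
        exact (hi i).2 (fun Q hQ => h Q ⟨i, hQ⟩) 𝔭 h𝔭

end Triang

/-- Termination (no infinite chain of recursive calls, whatever choices are made, and no call that
gets stuck) and correctness (of every possible output) of `Triangulate`. -/
theorem theorem4p2 (n : ℕ) (U : Subgroup ℝˣ) (A S : Finset (Triang.Poly n))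
    (hS : (0 : Triang.Poly n) ∉ S) :
    Acc (fun Q P : Triang.System n => Triang.Calls U P Q) (A, S) ∧
    (∀ P : Triang.System n, Relation.ReflTransGen (Triang.Calls U) (A, S) P →
      ∃ O, Triang.Returns U P O) ∧
    ∀ O : Finset (Triang.System n), Triang.Returns U (A, S) O →
      (∀ P ∈ O, Triang.IsRegularSystem U P.1 P.2) ∧
      (Triang.saturation (Ideal.span (A : Set (Triang.Poly n))) (S : Set (Triang.Poly n))).radical =
        ⨅ P ∈ O, Triang.saturation (Ideal.span (P.1 : Set (Triang.Poly n)))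
          (P.2 : Set (Triang.Poly n)) :=
  ⟨(Triang.wellFounded_calls n U).apply _, fun P _ => Triang.exists_returns U P,
    fun _ hO => hO.correct hS⟩
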